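/- Let $A$ (actions) and $Y$ (outcomes) be finite sets, $u:A\times Y\to\mathbb{R}$ a utility function, $Q\subset\Delta(Y)^A$ a finite set of models $q=(q_a)_{a\in A}$, $\pi_0\in\Delta(Q)$ a prior, $p^\star=(p^\star_a)_{a\in A}\in\Delta(Y)^A$ the true data-generating process, and $c>0$. For $\lambda>0$, $\mu\in\mathbb{R}$ and $\pi\in\Delta(Q)$ put $$v_{\lambda,\mu}(a;q)=\min_{p\in\Delta(Y)}\Big\{\sum_{y}u(a,y)p(y)+\tfrac1\lambda R(p\Vert q_a)+\mu H(p)\Big\},\qquad V_{\lambda,\mu}(a;\pi)=\sum_{q\in Q}v_{\lambda,\mu}(a;q)\,\pi(q),$$ where $R(p\Vert q)=\sum_y p(y)\log\frac{p(y)}{q(y)}$ and $H(p)=-\sum_y p(y)\log p(y)$. For a history $h_t=(a_1,y_1,\dots,a_t,y_t)$ let $\pi_t\in\Delta(Q)$ be the Bayesian posterior of $\pi_0$ and, for $t\ge1$, let $$\lambda_t=\Lambda(h_t)=\frac1{ct}\operatorname{LLR}(h_t;Q),\qquad \operatorname{LLR}(h_t;Q)=-\log\frac{\max_{q\in Q}\prod_{\tau=1}^t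 q_{a_\tau}(y_\tau)}{\max_{p\in\Delta(Y)^A}\prod_{\tau=1}^t p_{a_\tau}(y_\tau)}.$$ A policy $\sigma$ assigns an action to every finite history; with $p^\star$ it induces a probability measure $\mathbb{P}_\sigma$ on infinite paths $(a_1,y_1,a_2,y_2,\dots)$, under which $a_{t+1}=\sigma(h_t)$ and $y_{t+1}$ has conditional law $p^\star_{a_{t+1}}$ given $h_t$. For $\bar\mu\ge0$ the policy is $\bar\mu$-optimal if $\sigma(h_t)\in\arg\max_{a\in A}V_{\lambda_t,\bar\mu\lambda_t}(a;\pi_t)$ at every history $h_t$, $t\ge1$, with $\lambda_t>0$. Let $\alpha_t(a)=\frac1t\sum_{\tau=1}^t\mathbf 1\{a_\tau=a\}$. A random mixed action $\alpha^\Lambda\in\Delta(A)$ is a $\Lambda$-limit frequency of $\sigma$ if $\mathbb{P}_\sigma\big(\limsup_{t\to\infty}\|\alpha_t-\alpha^\Lambda\|_1\le\varepsilon\big)>0$ for every $\varepsilon>0$. Assume: 1. (full support) $q_a(y)>0$ for all $q\in Q$, $a\in A$, $y\in Y$; 2. (bounded concern) $\mathbb{P}_\sigma$-a.s., $0<\lambda_t\le\bar\lambda$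 for all $t\ge1$, and $\bar\mu\ge0$ satisfies $\bar\mu\bar\lambda^2<1$; 3. (correct specification) there is $q^\star\in Q$ with $q^\star_a=p^\star_a$ for all $a\in A$, and $\pi_0(q^\star)>0$. Let $\sigma$ be a $\bar\mu$-optimal policy and $\alpha^\Lambda$ a $\Lambda$-limit frequency of $\sigma$. Then for $\mathbb{P}_\sigma$-almost every path the following holds: for every $a\in A$ with $\alpha^\Lambda(a)>0$ such that the empirical frequencies get and remain close to $\alpha^\Lambda$ in the sense that $\limsup_{t\to\infty}\|\alpha_t-\alpha^\Lambda\|_1<\alpha^\Lambda(a)$ (in particular whenever $\alpha_t\to\alpha^\Lambda$ along the path), $$V_{\lambda_t,\bar\mu\lambda_t}(a;\pi_t)\longrightarrow\mathbb{E}_{p^\star_a}[u(a,Y)]=\sum_{y\in Y}p^\star_a(y)\,u(a,y)\qquad(t\to\infty).$$ -/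

import Mathlib

open MeasureTheory ProbabilityTheory Filter Topology

namespace ComplexityAversion

noncomputable section

/-! ### The static criterion -/

/-- Shannon entropy `H(p) = - ∑ y, p y * log (p y)` (with `0 log 0 = 0`). -/
def entropy {Y : Type*} [Fintype Y] (p : stdSimplex ℝ Y) : ℝ :=
  -∑ y, p y * Real.log (p y)

/-- Relative entropy `R(p ‖ q) = ∑ y, p y * log (p y / q y)`, for `p ≪ q`. -/
def relEntropy {Y : Type*} [Fintype Y] (p q : stdSimplex ℝ Y) : ℝ :=
  ∑ y, p y * Real.log (p y / q y)

/-- The robust value `v_{lam,mu}(a;q)` for `lam > 0`, where `w = u(a,·)` and `r = q_a`: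
the minimum over `p ∈ Δ(Y)` of `E_p[w] + (1/lam) R(p ‖ r) + mu H(p)`. Distributions that are not
absolutely continuous with respect to `r` have infinite relative entropy, so that they are left
out of the minimization. -/
def robustValue {Y : Type*} [Fintype Y] (w : Y → ℝ) (lam mu : ℝ) (r : stdSimplex ℝ Y) : ℝ :=
  sInf ((fun p : stdSimplex ℝ Y =>
      ∑ y, w y * p y + 1 / lam * relEntropy p r + mu * entropy p) ''
    {p | ∀ y, r y = 0 → p y = 0})

/-- The value `V_{lam,mu}(a;π) = ∑_{q ∈ Q} v_{lam,mu}(a;q) π(q)` of action `a` under the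
belief `π` over the finite set of models `Q`. -/
def beliefValue {A Y : Type*} [Fintype Y] (u : A → Y → ℝ) {Q : Finset (A → stdSimplex ℝ Y)}
    (lam mu : ℝ) (a : A) (π : Q → ℝ) : ℝ :=
  ∑ q : Q, robustValue (u a) lam mu (q.1 a) * π q

/-- The best replies `argmax_{a ∈ A} V_{lam,mu}(a;π)`. -/
def bestReplies {A Y : Type*} [Fintype Y] (u : A → Y → ℝ) {Q : Finset (A → stdSimplex ℝ Y)}
    (lam mu : ℝ) (π : Q → ℝ) : Set A :=
  {a | ∀ b, beliefValue u lam mu b π ≤ beliefValue u lam mu a π}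

/-! ### Histories, beliefs and misspecification concern -/

/-- Histories `h_t = (a_1, y_1, …, a_t, y_t)` of length `t`. -/
abbrev History (A Y : Type*) (t : ℕ) : Type _ := Fin t → A × Y

/-- Pure policies: an action `a_{t+1} = σ t h_t` after each finite history `h_t`. -/
abbrev Policy (A Y : Type*) : Type _ := (t : ℕ) → History A Y t → A

/-- The likelihood `∏_{τ ≤ t} q_{a_τ}(y_τ)` of a history under a model. -/
def likelihood {A Y : Type*} [Fintype Y] (q : A → stdSimplex ℝ Y) {t : ℕ}
    (h : History A Y t) : ℝ :=
  ∏ i, q (h i).1 (h i).2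

/-- The log-likelihood ratio between the structured models `Q` and the unrestricted class
`Δ(Y)^A`. -/
def LLR {A Y : Type*} [Fintype Y] (Q : Finset (A → stdSimplex ℝ Y)) {t : ℕ}
    (h : History A Y t) : ℝ :=
  -Real.log ((⨆ q : Q, likelihood q.1 h) / (⨆ p : A → stdSimplex ℝ Y, likelihood p h))

/-- The misspecification concern `lam_t = LLR(h_t; Q) / (c t)`, for `t ≥ 1`. -/
def concern {A Y : Type*} [Fintype Y] (c : ℝ) (Q : Finset (A → stdSimplex ℝ Y)) {t : ℕ}
    (h : History A Y t) : ℝ :=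
  1 / (c * t) * LLR Q h

/-- The Bayesian posterior over `Q` after a history, starting from the prior `π₀ ∈ Δ(Q)`. -/
def posterior {A Y : Type*} [Fintype Y] {Q : Finset (A → stdSimplex ℝ Y)}
    (π₀ : stdSimplex ℝ Q) {t : ℕ} (h : History A Y t) (q : Q) : ℝ :=
  π₀ q * likelihood q.1 h / ∑ q' : Q, π₀ q' * likelihood q'.1 h

/-- `mubar`-optimal policies: at every history the chosen action is a best reply to the posterior
for the parameters `(lam_t, mubar * lam_t)`. The criterion is defined for a positive concern only,
so nothing is required where `lam_t` is not positive; in particular nothing is required at the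
empty history, where the formula for `lam_t` has no meaning (here `concern` is `0` there). -/
def IsOptimal {A Y : Type*} [Fintype Y] (u : A → Y → ℝ) (c mubar : ℝ)
    {Q : Finset (A → stdSimplex ℝ Y)} (π₀ : stdSimplex ℝ Q) (σ : Policy A Y) : Prop :=
  ∀ (t : ℕ) (h : History A Y t), 0 < concern c Q h →
    σ t h ∈ bestReplies u (concern c Q h) (mubar * concern c Q h) (posterior π₀ h)

/-! ### The law of the process -/

/-- Infinite paths of play: `ω n = (a_{n+1}, y_{n+1})`. -/
abbrev Path (A Y : Type*) : Type _ := ℕ → A × Y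

/-- The history `h_t` along a path. -/
def histAt {A Y : Type*} (ω : Path A Y) (t : ℕ) : History A Y t := fun i => ω i

/-- The law of `(a, y)` when the action `a` is played and `y` is drawn from `p_a`. -/
def periodLaw {A Y : Type*} [Fintype Y] [MeasurableSpace A] [MeasurableSpace Y]
    (p : A → stdSimplex ℝ Y) (a : A) : Measure (A × Y) :=
  ∑ y, ENNReal.ofReal (p a y) • Measure.dirac (a, y)

instance isProbabilityMeasure_periodLaw {A Y : Type*} [Fintype Y] [MeasurableSpace A]
    [MeasurableSpace Y] (p : A → stdSimplex ℝ Y) (a : A) :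
    IsProbabilityMeasure (periodLaw p a) := by
  constructor
  simp only [periodLaw, Measure.coe_finsetSum, Finset.sum_apply, Measure.smul_apply,
    measure_univ, smul_eq_mul, mul_one]
  have h := ENNReal.ofReal_sum_of_nonneg (s := Finset.univ) (f := fun y => p a y)
    fun y _ => (p a).2.1 y
  rw [← h, stdSimplex.sum_eq_one, ENNReal.ofReal_one]

/-- The transition kernel of the process: given `h_{n+1}`, the action `a = σ_{n+1}(h_{n+1})` is
played and the outcome is drawn from `p_a`. -/
def stepKernel {A Y : Type*} [Fintype A] [Fintype Y] [MeasurableSpace A]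
    [DiscreteMeasurableSpace A] [MeasurableSpace Y] [DiscreteMeasurableSpace Y]
    (p : A → stdSimplex ℝ Y) (σ : Policy A Y) (n : ℕ) :
    Kernel ((i : Finset.Iic n) → (fun _ : ℕ => A × Y) i) (A × Y) :=
  Kernel.ofFunOfCountable fun x => periodLaw p
    (σ (n + 1) fun i => x ⟨i, Finset.mem_Iic.2 (Nat.lt_succ_iff.1 i.2)⟩)

instance isMarkovKernel_stepKernel {A Y : Type*} [Fintype A] [Fintype Y] [MeasurableSpace A]
    [DiscreteMeasurableSpace A] [MeasurableSpace Y] [DiscreteMeasurableSpace Y]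
    (p : A → stdSimplex ℝ Y) (σ : Policy A Y) (n : ℕ) :
    IsMarkovKernel (stepKernel p σ n) :=
  ⟨fun x => isProbabilityMeasure_periodLaw p
    (σ (n + 1) fun i => x ⟨i, Finset.mem_Iic.2 (Nat.lt_succ_iff.1 i.2)⟩)⟩

/-- The probability measure `ℙ_σ` on paths induced by the policy `σ` and the data-generating
process `p` (Ionescu-Tulcea). -/
def pathMeasure {A Y : Type*} [Fintype A] [Fintype Y] [MeasurableSpace A]
    [DiscreteMeasurableSpace A] [MeasurableSpace Y] [DiscreteMeasurableSpace Y]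
    (p : A → stdSimplex ℝ Y) (σ : Policy A Y) : Measure (Path A Y) :=
  Kernel.trajMeasure (X := fun _ => A × Y) (periodLaw p (σ 0 Fin.elim0)) (stepKernel p σ)

/-! ### Limit frequencies -/

open Classical in
/-- The empirical frequency `α_t(a)` of the action `a` in a history. -/
def empFreq {A Y : Type*} {t : ℕ} (h : History A Y t) (a : A) : ℝ :=
  1 / t * ∑ i, if (h i).1 = a then 1 else 0

/-- `limsup_t ‖α_t - α‖₁` along a path. -/
def freqGap {A Y : Type*} [Fintype A] (α : stdSimplex ℝ A) (ω : Path A Y) : ℝ :=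
  limsup (fun t : ℕ => ∑ a, |empFreq (histAt ω t) a - α a|) atTop

/-- The random mixed action `α` is a limit frequency of the policy `σ`: for every `ε > 0`, with
positive probability the empirical frequencies get and remain within `ε` of `α`. -/
def IsLimitFrequency {A Y : Type*} [Fintype A] [Fintype Y] [MeasurableSpace A]
    [DiscreteMeasurableSpace A] [MeasurableSpace Y] [DiscreteMeasurableSpace Y]
    (p : A → stdSimplex ℝ Y) (σ : Policy A Y) (α : Path A Y → stdSimplex ℝ A) : Prop :=
  Measurable α ∧ ∀ ε : ℝ, 0 < ε → 0 < pathMeasure p σ {ω | freqGap (α ω) ω ≤ ε}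

/-! ### Assumptions -/

/-- Every structured model has full support. -/
def FullSupport {A Y : Type*} [Fintype Y] (Q : Finset (A → stdSimplex ℝ Y)) : Prop :=
  ∀ q ∈ Q, ∀ a y, 0 < q a y

/-- Some structured model equals the data-generating process. -/
def CorrectlySpecified {A Y : Type*} [Fintype Y] (Q : Finset (A → stdSimplex ℝ Y))
    (p : A → stdSimplex ℝ Y) : Prop :=
  ∃ q ∈ Q, ∀ a, q a = p a

/-- Almost surely `0 < lam_t ≤ lambar` for all `t ≥ 1`. -/
def BoundedConcern {A Y : Type*} [Fintype A] [Fintype Y] [MeasurableSpace A]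
    [DiscreteMeasurableSpace A] [MeasurableSpace Y] [DiscreteMeasurableSpace Y]
    (c : ℝ) (Q : Finset (A → stdSimplex ℝ Y)) (p : A → stdSimplex ℝ Y) (σ : Policy A Y)
    (lambar : ℝ) : Prop :=
  ∀ᵐ ω ∂pathMeasure p σ, ∀ t : ℕ, 1 ≤ t →
    0 < concern c Q (histAt ω t) ∧ concern c Q (histAt ω t) ≤ lambar

end

end ComplexityAversion

/-! The concern dies out, and the posterior keeps only models that are right about `a`. Everything
rests on a strong law along the process (`ae_tendsto_average`): a function of `(a, y)` whose mean
under `p a` is zero for every action `a` averages to zero whatever the policy does, since the policy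
only selects the action. It comes from a Chernoff bound and Borel–Cantelli.

Concern: the true process lies in `Q`, so the log-likelihood ratio is at most the gain of an
unrestricted fit over the truth. By `likelihood_le_mul_exp` this gain is bounded by a weighted sum
of deviations of outcome counts from their compensators. The strong law makes these deviations
`o(t)`, so the concern tends to zero (`tendsto_concern`), and robust values then tend to expected
utilities (`tendsto_robustValue`).

Posterior: when `a` has asymptotic frequency bounded below, each of its plays costs a model that
misfits `a` a fixed relative entropy on average, while the other actions cannot help that model. Its
weight decays exponentially (`tendsto_posterior_zero`). Surviving models may disagree with the truth
elsewhere, but they all value `a` correctly in the limit (`tendsto_beliefValue`). -/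

namespace ComplexityAversion

/-! ### Strong law of large numbers under an arbitrary policy -/

section LawOfLargeNumbers

/-- Integration against the one-period law. -/
theorem lintegral_periodLaw {A Y : Type*} [Countable A] [Fintype Y] [MeasurableSpace A]
    [DiscreteMeasurableSpace A] [MeasurableSpace Y] [DiscreteMeasurableSpace Y]
    (p : A → stdSimplex ℝ Y) (a : A)
    (g : A × Y → ENNReal) :
    ∫⁻ z, g z ∂periodLaw p a = ∑ y, ENNReal.ofReal (p a y) * g (a, y) := by
  simp [periodLaw, lintegral_finsetSum_measure, lintegral_smul_measure, lintegral_dirac]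

/-- The exponential moment of a centered variable bounded by one. -/
theorem lintegral_exp_periodLaw_le {A Y : Type*} [Countable A] [Fintype Y] [MeasurableSpace A]
    [DiscreteMeasurableSpace A] [MeasurableSpace Y] [DiscreteMeasurableSpace Y]
    (p : A → stdSimplex ℝ Y) (x : A × Y → ℝ)
    (hx : ∀ z, |x z| ≤ 1) (hx0 : ∀ a, ∑ y, p a y * x (a, y) = 0) (s : ℝ) (hs : |s| ≤ 1) (a : A) :
    ∫⁻ z, ENNReal.ofReal (Real.exp (s * x z)) ∂periodLaw p a
      ≤ ENNReal.ofReal (Real.exp (s ^ 2)) := by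
  have hp : ∀ y, 0 ≤ p a y := fun y => (p a).2.1 y
  rw [lintegral_periodLaw]
  simp_rw [← ENNReal.ofReal_mul (hp _)]
  rw [← ENNReal.ofReal_sum_of_nonneg fun y _ => mul_nonneg (hp y) (Real.exp_pos _).le]
  refine ENNReal.ofReal_le_ofReal ?_
  have hterm : ∀ y, p a y * Real.exp (s * x (a, y))
      ≤ p a y * (1 + s ^ 2) + s * (p a y * x (a, y)) := by
    intro y
    have h1 : |s * x (a, y)| ≤ 1 := by
      rw [abs_mul]
      exact mul_le_one₀ hs (abs_nonneg _) (hx _)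
    -- `exp v ≤ 1 + v + v ^ 2` for `|v| ≤ 1`; the linear term integrates to zero.
    have h2 := (abs_le.1 (Real.abs_exp_sub_one_sub_id_le h1)).2
    have h3 : (s * x (a, y)) ^ 2 ≤ s ^ 2 := by
      rw [mul_pow]
      exact mul_le_of_le_one_right (sq_nonneg s) ((sq_le_one_iff_abs_le_one _).2 (hx _))
    have h4 : Real.exp (s * x (a, y)) ≤ 1 + s ^ 2 + s * x (a, y) := by linarith
    calc _ ≤ p a y * (1 + s ^ 2 + s * x (a, y)) := mul_le_mul_of_nonneg_left h4 (hp y)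
      _ = _ := by ring
  calc ∑ y, p a y * Real.exp (s * x (a, y))
      ≤ ∑ y, (p a y * (1 + s ^ 2) + s * (p a y * x (a, y))) :=
        Finset.sum_le_sum fun y _ => hterm y
    _ = 1 + s ^ 2 := by
        rw [Finset.sum_add_distrib, ← Finset.sum_mul, ← Finset.mul_sum, hx0,
          stdSimplex.sum_eq_one]
        ring
    _ ≤ Real.exp (s ^ 2) := by linarith [Real.add_one_le_exp (s ^ 2)]

variable {A Y : Type*} [Fintype A] [Fintype Y] [MeasurableSpace A]
    [DiscreteMeasurableSpace A] [MeasurableSpace Y] [DiscreteMeasurableSpace Y]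

instance isProbabilityMeasure_pathMeasure (p : A → stdSimplex ℝ Y) (σ : Policy A Y) :
    IsProbabilityMeasure (pathMeasure p σ) := by
  unfold pathMeasure
  infer_instance

/-- A bound on the one-period conditional expectations of `g` lifts to expectations of `F * g`
for a function `F` of the past. -/
theorem lintegral_mul_le_of_periodLaw_le (p : A → stdSimplex ℝ Y) (σ : Policy A Y) (n : ℕ)
    (F : ((i : Finset.Iic n) → A × Y) → ENNReal) (g : A × Y → ENNReal) (K : ENNReal)
    (hg : ∀ a, ∫⁻ z, g z ∂periodLaw p a ≤ K) :
    ∫⁻ ω, F (Preorder.frestrictLe (π := fun _ => A × Y) n ω) * g (ω (n + 1)) ∂pathMeasure p σ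
      ≤ (∫⁻ ω, F (Preorder.frestrictLe (π := fun _ => A × Y) n ω) ∂pathMeasure p σ) * K := by
  have hF : Measurable F := measurable_of_countable F
  have hgm : Measurable g := measurable_of_countable g
  have key := Kernel.map_frestrictLe_trajMeasure_compProd_eq_map_trajMeasure
    (X := fun _ => A × Y) (μ₀ := periodLaw p (σ 0 Fin.elim0)) (κ := stepKernel p σ) (a := n)
  have hmeas : Measurable fun z : ((i : Finset.Iic n) → A × Y) × (A × Y) => F z.1 * g z.2 :=
    (hF.comp measurable_fst).mul (hgm.comp measurable_snd)
  have hrest : Measurable (Preorder.frestrictLe (π := fun _ : ℕ => A × Y) n) := by fun_prop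
  calc ∫⁻ ω, F (Preorder.frestrictLe (π := fun _ => A × Y) n ω) * g (ω (n + 1)) ∂pathMeasure p σ
      = ∫⁻ z, F z.1 * g z.2 ∂((pathMeasure p σ).map
          fun x => (Preorder.frestrictLe (π := fun _ => A × Y) n x, x (n + 1))) := by
        rw [lintegral_map hmeas (by fun_prop)]
    _ = ∫⁻ x, ∫⁻ z, F x * g z ∂(stepKernel p σ n x)
          ∂((pathMeasure p σ).map (Preorder.frestrictLe (π := fun _ => A × Y) n)) := by
        unfold pathMeasure
        rw [← key, Measure.lintegral_compProd hmeas]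
    _ ≤ ∫⁻ x, F x * K
          ∂((pathMeasure p σ).map (Preorder.frestrictLe (π := fun _ => A × Y) n)) := by
        refine lintegral_mono fun x => ?_
        rw [lintegral_const_mul _ hgm]
        gcongr
        -- Given any past, the kernel is `periodLaw` at the action the policy picks, so the bound
        -- uniform in actions applies.
        exact hg _
    _ = _ := by
        rw [lintegral_mul_const _ hF, lintegral_map hF hrest]

/-- Exponential moments of sums of centered variables bounded by one. -/
theorem lintegral_exp_sum_le (p : A → stdSimplex ℝ Y) (σ : Policy A Y) (x : A × Y → ℝ)
    (hx : ∀ z, |x z| ≤ 1) (hx0 : ∀ a, ∑ y, p a y * x (a, y) = 0) (s : ℝ) (hs : |s| ≤ 1) (n : ℕ) :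
    ∫⁻ ω, ENNReal.ofReal (Real.exp (s * ∑ i ∈ Finset.range (n + 1), x (ω i))) ∂pathMeasure p σ
      ≤ ENNReal.ofReal (Real.exp (1 + n * s ^ 2)) := by
  induction n with
  | zero =>
    -- The initial period is not a kernel step; bounding its factor by `exp 1` gives the `1` in the
    -- exponent.
    calc _ ≤ ∫⁻ _, ENNReal.ofReal (Real.exp 1) ∂pathMeasure p σ := by
          refine lintegral_mono fun ω => ENNReal.ofReal_le_ofReal (Real.exp_le_exp.2 ?_)
          have h1 : |s * x (ω 0)| ≤ 1 := by
            rw [abs_mul]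
            exact mul_le_one₀ hs (abs_nonneg _) (hx _)
          simpa using (abs_le.1 h1).2
      _ = _ := by simp
  | succ n ih =>
    let F : ((i : Finset.Iic n) → A × Y) → ENNReal := fun h => ENNReal.ofReal (Real.exp
      (s * ∑ i : Fin (n + 1), x (h ⟨i, Finset.mem_Iic.2 (Nat.lt_succ_iff.1 i.2)⟩)))
    have hF : ∀ ω : Path A Y, F (Preorder.frestrictLe (π := fun _ => A × Y) n ω)
        = ENNReal.ofReal (Real.exp (s * ∑ i ∈ Finset.range (n + 1), x (ω i))) := by
      intro ω
      rw [← Fin.sum_univ_eq_sum_range (fun i => x (ω i))]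
      rfl
    have hstep := lintegral_mul_le_of_periodLaw_le p σ n F _ _
      (lintegral_exp_periodLaw_le p x hx hx0 s hs)
    simp_rw [hF] at hstep
    simp_rw [Finset.sum_range_succ _ (n + 1), mul_add, Real.exp_add,
      ENNReal.ofReal_mul (Real.exp_pos _).le]
    refine hstep.trans ?_
    refine (mul_le_mul_left ih _).trans_eq ?_
    simp only [← ENNReal.ofReal_mul (Real.exp_pos _).le, ← Real.exp_add]
    congr 2
    push_cast
    ring

/-- Centered sums are eventually below `ε t`. -/
theorem ae_eventually_sum_lt (p : A → stdSimplex ℝ Y) (σ : Policy A Y) (x : A × Y → ℝ)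
    (hx : ∀ z, |x z| ≤ 1) (hx0 : ∀ a, ∑ y, p a y * x (a, y) = 0) (ε : ℝ) (hε : 0 < ε)
    (hε1 : ε ≤ 1) :
    ∀ᵐ ω ∂pathMeasure p σ, ∀ᶠ n : ℕ in atTop,
      ∑ i ∈ Finset.range (n + 1), x (ω i) < ε * n := by
  have hbound : ∀ n : ℕ, pathMeasure p σ
      {ω | ε * n ≤ ∑ i ∈ Finset.range (n + 1), x (ω i)}
        ≤ ENNReal.ofReal (Real.exp 1 * Real.exp (-(ε ^ 2 / 4)) ^ n) := by
    intro n
    have hmeas : Measurable fun ω : Path A Y =>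
        ENNReal.ofReal (Real.exp (ε / 2 * ∑ i ∈ Finset.range (n + 1), x (ω i))) := by
      have hxm : Measurable x := measurable_of_countable x
      fun_prop
    -- Chernoff with `s = ε / 2`: the exponent is `1 + n ε² / 4 - n ε² / 2 = 1 - n ε² / 4`, hence
    -- summable.
    have hsub : {ω : Path A Y | ε * n ≤ ∑ i ∈ Finset.range (n + 1), x (ω i)}
        ⊆ {ω | ENNReal.ofReal (Real.exp (ε / 2 * (ε * n)))
          ≤ ENNReal.ofReal (Real.exp (ε / 2 * ∑ i ∈ Finset.range (n + 1), x (ω i)))} := by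
      intro ω hω
      exact ENNReal.ofReal_le_ofReal (Real.exp_le_exp.2
        (mul_le_mul_of_nonneg_left hω (by positivity)))
    refine (measure_mono hsub).trans ((meas_ge_le_lintegral_div hmeas.aemeasurable
      (by simp [Real.exp_pos]) (by simp)).trans ?_)
    refine (ENNReal.div_le_div_right (lintegral_exp_sum_le p σ x hx hx0 (ε / 2)
      (by rw [abs_of_pos (by positivity)]; linarith) n) _).trans_eq ?_
    rw [← ENNReal.ofReal_div_of_pos (Real.exp_pos _), ← Real.exp_sub, ← Real.exp_nat_mul,
      ← Real.exp_add]
    congr 2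
    ring
  have hsum : ∑' n : ℕ, pathMeasure p σ
      {ω | ε * n ≤ ∑ i ∈ Finset.range (n + 1), x (ω i)} ≠ ⊤ := by
    refine ne_top_of_le_ne_top ?_ (ENNReal.tsum_le_tsum hbound)
    have hs : Summable fun n : ℕ => Real.exp 1 * Real.exp (-(ε ^ 2 / 4)) ^ n :=
      (summable_geometric_of_lt_one (Real.exp_pos _).le
        (Real.exp_lt_one_iff.2 (by nlinarith [sq_pos_of_pos hε]))).mul_left _
    exact hs.tsum_ofReal_ne_top
  filter_upwards [ae_eventually_notMem hsum] with ω hω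
  filter_upwards [hω] with n hn
  exact not_le.1 hn

/-- Strong law of large numbers along the process for a variable of conditional mean zero. -/
theorem ae_tendsto_average (p : A → stdSimplex ℝ Y) (σ : Policy A Y) (x : A × Y → ℝ)
    (hx0 : ∀ a, ∑ y, p a y * x (a, y) = 0) :
    ∀ᵐ ω ∂pathMeasure p σ,
      Tendsto (fun t : ℕ => (∑ i ∈ Finset.range t, x (ω i)) / t) atTop (𝓝 0) := by
  set M : ℝ := 1 + ∑ z, |x z| with hM
  have hMpos : 0 < M := by positivity
  have hxM : ∀ z, |x z / M| ≤ 1 := by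
    intro z
    rw [abs_div, abs_of_pos hMpos, div_le_one hMpos]
    have := Finset.single_le_sum (f := fun z => |x z|) (fun z _ => abs_nonneg _)
      (Finset.mem_univ z)
    linarith
  have hxM0 : ∀ a, ∑ y, p a y * (x (a, y) / M) = 0 := by
    intro a
    simp_rw [← mul_div_assoc]
    rw [← Finset.sum_div, hx0, zero_div]
  -- Only countably many tolerances `1 / (k + 1)`, so that a single null set suffices.
  have hall : ∀ᵐ ω ∂pathMeasure p σ, ∀ k : ℕ, ∀ᶠ n : ℕ in atTop,
      |∑ i ∈ Finset.range (n + 1), x (ω i) / M| < 1 / (k + 1) * n := by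
    refine ae_all_iff.2 fun k => ?_
    have hk : (0 : ℝ) < 1 / (k + 1) := by positivity
    have hk1 : (1 : ℝ) / (k + 1) ≤ 1 := by
      rw [div_le_one (by positivity)]
      linarith [Nat.cast_nonneg (α := ℝ) k]
    filter_upwards [ae_eventually_sum_lt p σ (fun z => x z / M) hxM hxM0 _ hk hk1,
      ae_eventually_sum_lt p σ (fun z => -(x z / M)) (by simpa using hxM)
        (by simpa using hxM0) _ hk hk1] with ω h1 h2
    filter_upwards [h1, h2] with n h1 h2
    rw [Finset.sum_neg_distrib] at h2
    exact abs_lt.2 ⟨by linarith, h1⟩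
  filter_upwards [hall] with ω hω
  rw [← tendsto_add_atTop_iff_nat 1, Metric.tendsto_atTop']
  intro ε hε
  obtain ⟨k, hk⟩ := exists_nat_one_div_lt (div_pos hε hMpos)
  obtain ⟨N, hN⟩ := eventually_atTop.1 (hω k)
  refine ⟨N, fun n hn => ?_⟩
  have h := hN n hn.le
  rw [← Finset.sum_div, abs_div, abs_of_pos hMpos, div_lt_iff₀ hMpos] at h
  have hn0 : (0 : ℝ) ≤ n := Nat.cast_nonneg n
  rw [lt_div_iff₀ hMpos] at hk
  rw [Real.dist_eq, sub_zero, abs_div, Nat.abs_cast, div_lt_iff₀ (by positivity)]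
  push_cast
  nlinarith

end LawOfLargeNumbers

/-! ### Robust values for small concern -/

section RobustValue

variable {Y : Type*} [Fintype Y]

theorem entropy_nonneg (p : stdSimplex ℝ Y) : 0 ≤ entropy p := by
  rw [entropy, neg_nonneg]
  refine Finset.sum_nonpos fun y _ => mul_nonpos_of_nonneg_of_nonpos (p.2.1 y) ?_
  refine Real.log_nonpos (p.2.1 y) ?_
  have h := Finset.single_le_sum (f := fun y => p y) (fun y _ => p.2.1 y) (Finset.mem_univ y)
  rwa [stdSimplex.sum_eq_one] at h

theorem relEntropy_self (p : stdSimplex ℝ Y) : relEntropy p p = 0 := by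
  refine Finset.sum_eq_zero fun y _ => ?_
  by_cases h : p y = 0
  · simp [h]
  · simp [div_self h]

/-- Variational lower bound for the relative entropy. -/
theorem robust_objective_lower_bound (w : Y → ℝ) {lam : ℝ} (hlam : 0 < lam)
    (hw : ∀ y, |lam * w y| ≤ 1) (p r : stdSimplex ℝ Y) (hr : ∀ y, 0 < r y) :
    ∑ y, r y * w y - lam * ∑ y, r y * w y ^ 2
      ≤ ∑ y, w y * p y + 1 / lam * relEntropy p r := by
  have hterm : ∀ y, p y - r y + lam * (r y * w y) - lam ^ 2 * (r y * w y ^ 2)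
      ≤ lam * (w y * p y) + p y * Real.log (p y / r y) := by
    intro y
    have he : Real.exp (-(lam * w y)) ≤ 1 - lam * w y + (lam * w y) ^ 2 := by
      have := (abs_le.1 (Real.abs_exp_sub_one_sub_id_le (x := -(lam * w y))
        (by rw [abs_neg]; exact hw y))).2
      rw [neg_sq] at this
      linarith
    have hre := mul_le_mul_of_nonneg_left he (hr y).le
    rcases (p.2.1 y).eq_or_lt with h0 | hpos
    · have h0 : p y = 0 := h0.symm
      have := mul_pos (hr y) (Real.exp_pos (-(lam * w y)))
      rw [h0]
      simp only [zero_mul, mul_zero, add_zero]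
      nlinarith
    · have hpos : 0 < p y := hpos
      -- Tangent bound at the Gibbs tilt `r y * exp (-lam * w y)`, which gives `p log (p / r) + lam
      -- w p ≥ p - r exp (-lam w)`.
      have hl := Real.log_le_sub_one_of_pos (x := r y * Real.exp (-(lam * w y)) / p y)
        (div_pos (mul_pos (hr y) (Real.exp_pos _)) hpos)
      rw [Real.log_div (mul_pos (hr y) (Real.exp_pos _)).ne' hpos.ne',
        Real.log_mul (hr y).ne' (Real.exp_pos _).ne', Real.log_exp] at hl
      have hl2 := mul_le_mul_of_nonneg_left hl hpos.le
      rw [mul_sub (p y) (_ / _), mul_div_cancel₀ _ hpos.ne'] at hl2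
      rw [Real.log_div hpos.ne' (hr y).ne']
      nlinarith
  have hsum := Finset.sum_le_sum fun y (_ : y ∈ Finset.univ) => hterm y
  simp only [Finset.sum_add_distrib, Finset.sum_sub_distrib, ← Finset.mul_sum,
    stdSimplex.sum_eq_one, sub_self, zero_add] at hsum
  have h1 : lam * (∑ y, w y * p y + 1 / lam * relEntropy p r)
      = lam * ∑ y, w y * p y + ∑ y, p y * Real.log (p y / r y) := by
    rw [relEntropy]
    field_simp
  refine le_of_mul_le_mul_left ?_ hlam
  rw [h1]
  linarith

/-- The robust value differs from the expected utility by at most a multiple of `lam`. -/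
theorem abs_robustValue_sub_le (w : Y → ℝ) {lam mubar : ℝ} (hlam : 0 < lam) (hmu : 0 ≤ mubar)
    (hw : ∀ y, |lam * w y| ≤ 1) (r : stdSimplex ℝ Y) (hr : ∀ y, 0 < r y) :
    |robustValue w lam (mubar * lam) r - ∑ y, r y * w y|
      ≤ lam * (∑ y, r y * w y ^ 2 + mubar * entropy r) := by
  have hent := entropy_nonneg r
  have hsq : 0 ≤ ∑ y, r y * w y ^ 2 :=
    Finset.sum_nonneg fun y _ => mul_nonneg (hr y).le (sq_nonneg _)
  have hlow : ∀ b ∈ (fun p : stdSimplex ℝ Y =>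
      ∑ y, w y * p y + 1 / lam * relEntropy p r + mubar * lam * entropy p) ''
      {p | ∀ y, r y = 0 → p y = 0}, ∑ y, r y * w y - lam * ∑ y, r y * w y ^ 2 ≤ b := by
    rintro _ ⟨p, -, rfl⟩
    have h1 := robust_objective_lower_bound w hlam hw p r hr
    have h2 : 0 ≤ mubar * lam * entropy p :=
      mul_nonneg (mul_nonneg hmu hlam.le) (entropy_nonneg p)
    simp only
    linarith
  -- The choice `p = r` has zero relative entropy and gives the upper bound.
  have hmem : ∑ y, r y * w y + mubar * lam * entropy r ∈ (fun p : stdSimplex ℝ Y =>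
      ∑ y, w y * p y + 1 / lam * relEntropy p r + mubar * lam * entropy p) ''
      {p | ∀ y, r y = 0 → p y = 0} := by
    refine ⟨r, fun y h => h, ?_⟩
    simp only [relEntropy_self, mul_zero, add_zero, mul_comm (w _)]
  have hle := csInf_le ⟨_, hlow⟩ hmem
  have hge := le_csInf ⟨_, hmem⟩ hlow
  rw [abs_le, robustValue]
  have h3 : 0 ≤ lam * (mubar * entropy r) := by positivity
  have h4 : 0 ≤ lam * ∑ y, r y * w y ^ 2 := by positivity
  constructor
  · rw [mul_add]
    linarith
  · rw [mul_add]
    linarith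

/-- The robust value tends to the expected utility as the concern vanishes. -/
theorem tendsto_robustValue (w : Y → ℝ) {mubar : ℝ} (hmu : 0 ≤ mubar) (r : stdSimplex ℝ Y)
    (hr : ∀ y, 0 < r y) :
    Tendsto (fun lam => robustValue w lam (mubar * lam) r) (𝓝[>] 0) (𝓝 (∑ y, r y * w y)) := by
  rw [tendsto_iff_norm_sub_tendsto_zero]
  have hsmall : ∀ᶠ lam : ℝ in 𝓝[>] 0, ∀ y, |lam * w y| ≤ 1 := by
    refine eventually_all.2 fun y => ?_
    have h : Tendsto (fun lam : ℝ => |lam * w y|) (𝓝[>] 0) (𝓝 0) := by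
      have : Continuous fun lam : ℝ => |lam * w y| := by fun_prop
      simpa using (this.tendsto 0).mono_left nhdsWithin_le_nhds
    exact h.eventually_le_const one_pos
  have hzero : Tendsto (fun lam : ℝ => lam * (∑ y, r y * w y ^ 2 + mubar * entropy r))
      (𝓝[>] 0) (𝓝 0) := by
    have : Continuous fun lam : ℝ => lam * (∑ y, r y * w y ^ 2 + mubar * entropy r) := by
      fun_prop
    simpa using (this.tendsto 0).mono_left nhdsWithin_le_nhds
  refine squeeze_zero' (Eventually.of_forall fun _ => norm_nonneg _) ?_ hzero
  filter_upwards [hsmall, self_mem_nhdsWithin] with lam hw hlam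
  exact abs_robustValue_sub_le w hlam hmu hw r hr

end RobustValue

/-- Write `x / y = (x n / k) * (k / (n y))` and apply `s ≤ exp (s - 1)` to both factors. In the use
below, `k` is an outcome count among `n` plays of an action, and `x`, `y` are its probabilities
under a competitor and the truth. The terms `x n - k` then cancel over outcomes. -/
theorem pow_le_pow_mul_exp {x y n : ℝ} {k : ℕ} (hx : 0 ≤ x) (hy : 0 < y)
    (hk : (k : ℝ) ≤ n) :
    x ^ k ≤ y ^ k * Real.exp (x * n - k + |k - y * n| / y) := by
  have hn : 0 ≤ n := (Nat.cast_nonneg k).trans hk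
  rcases Nat.eq_zero_or_pos k with rfl | hk0
  · simp only [pow_zero, one_mul, Nat.cast_zero, sub_zero]
    exact Real.one_le_exp (by positivity)
  have hkR : (0 : ℝ) < k := Nat.cast_pos.2 hk0
  have hn0 : 0 < n := hkR.trans_le hk
  have h1 : x * n / k ≤ Real.exp (x * n / k - 1) := by
    linarith [Real.add_one_le_exp (x * n / k - 1)]
  have h2 : k / (n * y) ≤ Real.exp (k / (n * y) - 1) := by
    linarith [Real.add_one_le_exp (k / (n * y) - 1)]
  have h3 : x ≤ y * (Real.exp (x * n / k - 1) * Real.exp (k / (n * y) - 1)) := by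
    calc x = y * (x * n / k * (k / (n * y))) := by field_simp
      _ ≤ _ := by
        gcongr
  calc x ^ k ≤ (y * (Real.exp (x * n / k - 1) * Real.exp (k / (n * y) - 1))) ^ k :=
        pow_le_pow_left₀ hx h3 k
    _ = y ^ k * Real.exp (x * n - k + k * (k / (n * y) - 1)) := by
        rw [mul_pow, ← Real.exp_add, ← Real.exp_nat_mul]
        congr 2
        field_simp
    _ ≤ _ := by
        gcongr
        have h4 : (k : ℝ) * (k / (n * y) - 1) = k / n * ((k - y * n) / y) := by
          field_simp
        rw [h4]
        calc k / n * ((k - y * n) / y) ≤ k / n * (|k - y * n| / y) := by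
              gcongr
              exact le_abs_self _
          _ ≤ 1 * (|k - y * n| / y) := by
              gcongr
              exact (div_le_one hn0).2 hk
          _ = _ := one_mul _

/-! ### Likelihood ratios and the vanishing concern -/

section Likelihood

variable {A Y : Type*} [Fintype Y]

theorem likelihood_nonneg (q : A → stdSimplex ℝ Y) {t : ℕ} (h : History A Y t) :
    0 ≤ likelihood q h :=
  Finset.prod_nonneg fun i _ => (q (h i).1).2.1 (h i).2

theorem likelihood_pos {q : A → stdSimplex ℝ Y} (hq : ∀ a y, 0 < q a y) {t : ℕ}
    (h : History A Y t) : 0 < likelihood q h :=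
  Finset.prod_pos fun _ _ => hq _ _

open Classical in
/-- The number of occurrences of the pair `z` in a history. -/
noncomputable def pairCount {t : ℕ} (h : History A Y t) (z : A × Y) : ℕ :=
  (Finset.univ.filter fun i => h i = z).card

open Classical in
/-- The number of occurrences of the pair `z`, compensated by its conditional mean. -/
noncomputable def deviation (p : A → stdSimplex ℝ Y) (z z' : A × Y) : ℝ :=
  (if z' = z then 1 else 0) - p z.1 z.2 * if z'.1 = z.1 then 1 else 0

theorem sum_deviation_eq_zero (p : A → stdSimplex ℝ Y) (z : A × Y) (a : A) :
    ∑ y, p a y * deviation p z (a, y) = 0 := by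
  classical
  obtain ⟨b, y⟩ := z
  by_cases hab : a = b
  · subst hab
    simp [deviation, mul_sub, Finset.sum_sub_distrib, ← Finset.sum_mul]
  · simp [deviation, hab]

open Classical in
theorem sum_pairCount (a : A) {t : ℕ} (h : History A Y t) :
    ∑ y, (pairCount h (a, y) : ℝ) = ∑ i, if (h i).1 = a then (1 : ℝ) else 0 := by
  simp only [pairCount, Finset.card_filter, Nat.cast_sum]
  rw [Finset.sum_comm]
  refine Finset.sum_congr rfl fun i _ => ?_
  by_cases hi : (h i).1 = a
  · simp [Prod.ext_iff, hi]
  · simp [Prod.ext_iff, hi]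

open Classical in
theorem sum_deviation_eq (p : A → stdSimplex ℝ Y) (z : A × Y) {t : ℕ} (h : History A Y t) :
    ∑ i, deviation p z (h i)
      = pairCount h z - p z.1 z.2 * ∑ i, if (h i).1 = z.1 then (1 : ℝ) else 0 := by
  simp only [deviation, Finset.sum_sub_distrib, ← Finset.mul_sum, pairCount, Finset.card_filter]
  push_cast
  rfl

variable [Fintype A]

theorem likelihood_eq_prod_pow (q : A → stdSimplex ℝ Y) {t : ℕ} (h : History A Y t) :
    likelihood q h = ∏ z : A × Y, q z.1 z.2 ^ pairCount h z := by
  classical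
  rw [likelihood, ← Finset.prod_fiberwise Finset.univ h]
  refine Finset.prod_congr rfl fun z _ => ?_
  rw [pairCount, ← Finset.prod_const]
  refine Finset.prod_congr (by congr) fun i hi => ?_
  rw [(Finset.mem_filter.1 hi).2]

/-- No model has a likelihood much higher than that of `p` when the outcome counts are close to
their conditional means under `p`. -/
theorem likelihood_le_mul_exp {p : A → stdSimplex ℝ Y} (hp : ∀ a y, 0 < p a y)
    (q : A → stdSimplex ℝ Y) {t : ℕ} (h : History A Y t) :
    likelihood q h
      ≤ likelihood p h * Real.exp (∑ z : A × Y, |∑ i, deviation p z (h i)| / p z.1 z.2) := by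
  classical
  set n : A → ℝ := fun a => ∑ i, if (h i).1 = a then (1 : ℝ) else 0 with hn
  have hle : ∀ z : A × Y, (pairCount h z : ℝ) ≤ n z.1 := by
    intro z
    simp only [hn]
    rw [← sum_pairCount z.1 h]
    exact Finset.single_le_sum (f := fun y => (pairCount h (z.1, y) : ℝ))
      (fun y _ => Nat.cast_nonneg _) (Finset.mem_univ z.2)
  -- For each action, the probabilities under `q` sum to one and the outcome counts sum to the
  -- number of plays.
  have hzero : ∑ z : A × Y, (q z.1 z.2 * n z.1 - pairCount h z) = 0 := by
    rw [Fintype.sum_prod_type]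
    refine Finset.sum_eq_zero fun a _ => ?_
    simp only [Finset.sum_sub_distrib, ← Finset.sum_mul, stdSimplex.sum_eq_one, sum_pairCount,
      one_mul, hn, sub_self]
  calc likelihood q h = ∏ z : A × Y, q z.1 z.2 ^ pairCount h z := likelihood_eq_prod_pow q h
    _ ≤ ∏ z : A × Y, (p z.1 z.2 ^ pairCount h z * Real.exp (q z.1 z.2 * n z.1 - pairCount h z
          + |pairCount h z - p z.1 z.2 * n z.1| / p z.1 z.2)) :=
        Finset.prod_le_prod (fun z _ => pow_nonneg ((q z.1).2.1 z.2) _)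
          fun z _ => pow_le_pow_mul_exp ((q z.1).2.1 z.2) (hp _ _) (hle z)
    _ = _ := by
        rw [Finset.prod_mul_distrib, ← likelihood_eq_prod_pow, ← Real.exp_sum,
          Finset.sum_add_distrib, hzero, zero_add]
        simp_rw [sum_deviation_eq]
        rfl

/-- The constrained maximum is at least the likelihood of `p`, because `p ∈ Q`; the unconstrained
one exceeds it by at most the factor in `likelihood_le_mul_exp`. -/
theorem LLR_le {Q : Finset (A → stdSimplex ℝ Y)} {p : A → stdSimplex ℝ Y} (hpQ : p ∈ Q)
    (hp : ∀ a y, 0 < p a y) {t : ℕ} (h : History A Y t) :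
    LLR Q h ≤ ∑ z : A × Y, |∑ i, deviation p z (h i)| / p z.1 z.2 := by
  set D := ∑ z : A × Y, |∑ i, deviation p z (h i)| / p z.1 z.2 with hD
  -- A real `⨆` over an unbounded family is `0` by convention, so boundedness is needed for
  -- `le_ciSup`.
  have hbdd : BddAbove (Set.range fun q : A → stdSimplex ℝ Y => likelihood q h) :=
    ⟨_, by rintro _ ⟨q, rfl⟩; exact likelihood_le_mul_exp hp q h⟩
  have : Nonempty (A → stdSimplex ℝ Y) := ⟨p⟩
  have hL := likelihood_pos hp h
  have hup : (⨆ q : A → stdSimplex ℝ Y, likelihood q h) ≤ likelihood p h * Real.exp D :=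
    ciSup_le fun q => likelihood_le_mul_exp hp q h
  have hsup : 0 < ⨆ q : A → stdSimplex ℝ Y, likelihood q h := hL.trans_le (le_ciSup hbdd p)
  have hQ : likelihood p h ≤ ⨆ q : Q, likelihood q.1 h :=
    le_ciSup (f := fun q : Q => likelihood q.1 h) (Set.finite_range _).bddAbove ⟨p, hpQ⟩
  rw [LLR, neg_le, ← Real.log_exp (-D)]
  refine Real.log_le_log (Real.exp_pos _) ?_
  rw [le_div_iff₀ hsup, Real.exp_neg, inv_mul_le_iff₀ (Real.exp_pos _)]
  calc _ ≤ likelihood p h * Real.exp D := hup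
    _ = Real.exp D * likelihood p h := mul_comm _ _
    _ ≤ _ := by gcongr

/-- The concern vanishes under correct specification along paths where the law of large numbers
holds. -/
theorem tendsto_concern {c : ℝ} (hc : 0 < c) {Q : Finset (A → stdSimplex ℝ Y)}
    {p : A → stdSimplex ℝ Y} (hpQ : p ∈ Q) (hp : ∀ a y, 0 < p a y) {ω : Path A Y}
    (hω : ∀ z, Tendsto (fun t : ℕ => (∑ i ∈ Finset.range t, deviation p z (ω i)) / t)
      atTop (𝓝 0))
    (hpos : ∀ t : ℕ, 1 ≤ t → 0 < concern c Q (histAt ω t)) :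
    Tendsto (fun t : ℕ => concern c Q (histAt ω t)) atTop (𝓝[>] 0) := by
  refine tendsto_nhdsWithin_iff.2 ⟨?_, ?_⟩
  · have hlim : Tendsto (fun t : ℕ => 1 / c * ∑ z : A × Y,
        |(∑ i ∈ Finset.range t, deviation p z (ω i)) / t| / p z.1 z.2) atTop (𝓝 0) := by
      have := (tendsto_finsetSum Finset.univ fun z _ =>
        ((hω z).abs.div_const (p z.1 z.2))).const_mul (1 / c)
      simpa using this
    refine squeeze_zero' ?_ ?_ hlim
    · filter_upwards [eventually_ge_atTop 1] with t ht
      exact (hpos t ht).le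
    · filter_upwards [eventually_ge_atTop 1] with t ht
      have ht0 : (0 : ℝ) < t := Nat.cast_pos.2 ht
      have h1 := LLR_le hpQ hp (histAt ω t)
      calc concern c Q (histAt ω t)
          ≤ 1 / (c * t) * ∑ z : A × Y, |∑ i, deviation p z (histAt ω t i)| / p z.1 z.2 := by
            rw [concern]
            gcongr
        _ = _ := by
            rw [one_div_mul_eq_div, one_div_mul_eq_div, mul_comm c, ← div_div, Finset.sum_div]
            congr 1
            refine Finset.sum_congr rfl fun z _ => ?_
            rw [abs_div, Nat.abs_cast, ← Fin.sum_univ_eq_sum_range (fun i => deviation p z (ω i)),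
              div_right_comm]
            rfl
  · filter_upwards [eventually_ge_atTop 1] with t ht
    exact hpos t ht

end Likelihood

/-! ### Exponential decay of the posterior on misfitting models -/

section Posterior

variable {A Y : Type*} [Fintype Y]

/-- The log-likelihood ratio of `q` against `p`, compensated by its conditional mean. -/
noncomputable def compensatedLogRatio (p q : A → stdSimplex ℝ Y) (z : A × Y) : ℝ :=
  Real.log (q z.1 z.2 / p z.1 z.2) + relEntropy (p z.1) (q z.1)

theorem relEntropy_eq_neg (p q : stdSimplex ℝ Y) :
    relEntropy p q = -∑ y, p y * Real.log (q y / p y) := by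
  rw [relEntropy, ← Finset.sum_neg_distrib]
  refine Finset.sum_congr rfl fun y _ => ?_
  rw [← mul_neg, ← Real.log_inv, inv_div]

theorem sum_compensatedLogRatio_eq_zero (p q : A → stdSimplex ℝ Y) (a : A) :
    ∑ y, p a y * compensatedLogRatio p q (a, y) = 0 := by
  simp only [compensatedLogRatio, mul_add, Finset.sum_add_distrib, ← Finset.sum_mul,
    stdSimplex.sum_eq_one, one_mul, relEntropy_eq_neg]
  ring

theorem relEntropy_nonneg {p q : stdSimplex ℝ Y} (hp : ∀ y, 0 < p y) (hq : ∀ y, 0 < q y) :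
    0 ≤ relEntropy p q := by
  rw [relEntropy_eq_neg, neg_nonneg]
  calc ∑ y, p y * Real.log (q y / p y) ≤ ∑ y, (q y - p y) := by
        refine Finset.sum_le_sum fun y _ => ?_
        calc p y * Real.log (q y / p y) ≤ p y * (q y / p y - 1) :=
              mul_le_mul_of_nonneg_left (Real.log_le_sub_one_of_pos (div_pos (hq y) (hp y)))
                (hp y).le
          _ = q y - p y := by rw [mul_sub, mul_div_cancel₀ _ (hp y).ne', mul_one]
    _ = 0 := by simp [Finset.sum_sub_distrib]

/-- The inequality `log s ≤ s - 1` is strict for `s ≠ 1`, hence at an outcome where `q` and `p`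
differ. -/
theorem relEntropy_pos {p q : stdSimplex ℝ Y} (hp : ∀ y, 0 < p y) (hq : ∀ y, 0 < q y)
    (hne : q ≠ p) : 0 < relEntropy p q := by
  obtain ⟨y₀, hy₀⟩ : ∃ y, q y ≠ p y := by
    by_contra! h
    exact hne (Subtype.ext (funext h))
  have hterm : ∀ y, p y * (q y / p y - 1) = q y - p y := fun y => by
    rw [mul_sub, mul_div_cancel₀ _ (hp y).ne', mul_one]
  rw [relEntropy_eq_neg, neg_pos]
  calc ∑ y, p y * Real.log (q y / p y) < ∑ y, (q y - p y) := by
        refine Finset.sum_lt_sum (fun y _ => ?_) ⟨y₀, Finset.mem_univ _, ?_⟩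
        · rw [← hterm]
          exact mul_le_mul_of_nonneg_left (Real.log_le_sub_one_of_pos (div_pos (hq y) (hp y)))
            (hp y).le
        · rw [← hterm]
          refine mul_lt_mul_of_pos_left (Real.log_lt_sub_one_of_pos (div_pos (hq _) (hp _)) ?_)
            (hp _)
          rw [Ne, div_eq_one_iff_eq (hp _).ne']
          exact hy₀
    _ = 0 := by simp [Finset.sum_sub_distrib]

open Classical in
/-- A model that misfits the outcomes of an action played with frequency at least `δ` has a
relative likelihood that is exponentially small. -/
theorem likelihood_div_le {p q : A → stdSimplex ℝ Y} (hp : ∀ a y, 0 < p a y)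
    (hq : ∀ a y, 0 < q a y) (a : A) {t : ℕ} (h : History A Y t) :
    likelihood q h / likelihood p h ≤ Real.exp (∑ i, compensatedLogRatio p q (h i)
      - relEntropy (p a) (q a) * ∑ i, if (h i).1 = a then (1 : ℝ) else 0) := by
  have h1 : likelihood q h / likelihood p h
      = Real.exp (∑ i, Real.log (q (h i).1 (h i).2 / p (h i).1 (h i).2)) := by
    rw [likelihood, likelihood, ← Finset.prod_div_distrib, Real.exp_sum]
    refine Finset.prod_congr rfl fun i _ => ?_
    rw [Real.exp_log (div_pos (hq _ _) (hp _ _))]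
  rw [h1, Finset.mul_sum, ← Finset.sum_sub_distrib]
  -- The compensator is a nonnegative relative entropy in every period; it is kept where `a` is
  -- played and dropped elsewhere.
  refine Real.exp_le_exp.2 (Finset.sum_le_sum fun i _ => ?_)
  rw [compensatedLogRatio]
  by_cases hi : (h i).1 = a
  · simp [hi]
  · simp [hi, relEntropy_nonneg (hp _) (hq _)]

/-- The posterior probability of a model that misfits the outcomes of an action played with
positive asymptotic frequency vanishes. -/
theorem tendsto_posterior_zero {Q : Finset (A → stdSimplex ℝ Y)}
    (hfull : FullSupport Q) (π₀ : stdSimplex ℝ Q) (p q : Q) (hp0 : 0 < π₀ p)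
    {ω : Path A Y} (a : A) (hne : q.1 a ≠ p.1 a) {δ : ℝ} (hδ : 0 < δ)
    (hfreq : ∀ᶠ t : ℕ in atTop, δ ≤ empFreq (histAt ω t) a)
    (hω : Tendsto (fun t : ℕ => (∑ i ∈ Finset.range t, compensatedLogRatio p.1 q.1 (ω i)) / t)
      atTop (𝓝 0)) :
    Tendsto (fun t : ℕ => posterior π₀ (histAt ω t) q) atTop (𝓝 0) := by
  classical
  have hp := hfull p.1 p.2
  have hq := hfull q.1 q.2
  have hR := relEntropy_pos (hp a) (hq a) hne
  set R := relEntropy (p.1 a) (q.1 a)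
  -- The drift is at most `-R δ t`; half of it absorbs the fluctuations, which are eventually at
  -- most `R δ t / 2`.
  have hlim : Tendsto (fun t : ℕ => π₀ q / π₀ p * Real.exp (-(R * δ / 2) * t)) atTop (𝓝 0) := by
    have h1 : Tendsto (fun t : ℕ => -(R * δ / 2) * (t : ℝ)) atTop atBot :=
      tendsto_natCast_atTop_atTop.const_mul_atTop_of_neg (by have := mul_pos hR hδ; linarith)
    simpa using (Real.tendsto_exp_atBot.comp h1).const_mul (π₀ q / π₀ p)
  have hterm : ∀ (t : ℕ) (q' : Q), 0 ≤ π₀ q' * likelihood q'.1 (histAt ω t) :=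
    fun t q' => mul_nonneg (π₀.2.1 q') (likelihood_nonneg _ _)
  refine squeeze_zero' (Eventually.of_forall fun t => ?_) ?_ hlim
  · exact div_nonneg (hterm t q) (Finset.sum_nonneg fun q' _ => hterm t q')
  · filter_upwards [hfreq, eventually_gt_atTop 0,
      hω.eventually_le_const (show 0 < R * δ / 2 by positivity)] with t hf ht hsum
    have ht0 : (0 : ℝ) < t := Nat.cast_pos.2 ht
    have hLp := likelihood_pos hp (histAt ω t)
    have hden : π₀ p * likelihood p.1 (histAt ω t)
        ≤ ∑ q' : Q, π₀ q' * likelihood q'.1 (histAt ω t) :=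
      Finset.single_le_sum (fun q' _ => hterm t q') (Finset.mem_univ p)
    calc posterior π₀ (histAt ω t) q
        ≤ π₀ q * likelihood q.1 (histAt ω t) / (π₀ p * likelihood p.1 (histAt ω t)) :=
          div_le_div_of_nonneg_left (hterm t q) (mul_pos hp0 hLp) hden
      _ = π₀ q / π₀ p * (likelihood q.1 (histAt ω t) / likelihood p.1 (histAt ω t)) := by
          rw [mul_div_mul_comm]
      _ ≤ π₀ q / π₀ p * Real.exp (-(R * δ / 2) * t) := by
          refine mul_le_mul_of_nonneg_left ((likelihood_div_le hp hq a _).trans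
            (Real.exp_le_exp.2 ?_)) (div_nonneg (π₀.2.1 q) hp0.le)
          have h1 : ∑ i, compensatedLogRatio p.1 q.1 (histAt ω t i) ≤ R * δ / 2 * t := by
            rw [div_le_iff₀ ht0, ← Fin.sum_univ_eq_sum_range
              (fun i => compensatedLogRatio p.1 q.1 (ω i))] at hsum
            exact hsum
          have h2 : δ * t ≤ ∑ i, if (histAt ω t i).1 = a then (1 : ℝ) else 0 := by
            rw [empFreq, one_div_mul_eq_div, le_div_iff₀ ht0] at hf
            convert hf
          have h3 := mul_le_mul_of_nonneg_left h2 hR.le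
          linarith

theorem sum_posterior {Q : Finset (A → stdSimplex ℝ Y)} (hfull : FullSupport Q)
    (π₀ : stdSimplex ℝ Q) (p : Q) (hp0 : 0 < π₀ p) {t : ℕ} (h : History A Y t) :
    ∑ q : Q, posterior π₀ h q = 1 := by
  have hpos : 0 < ∑ q' : Q, π₀ q' * likelihood q'.1 h :=
    Finset.sum_pos' (fun q' _ => mul_nonneg (π₀.2.1 q') (likelihood_nonneg _ _))
      ⟨p, Finset.mem_univ _, mul_pos hp0 (likelihood_pos (hfull p.1 p.2) h)⟩
  simp only [posterior]
  rw [← Finset.sum_div, div_self hpos.ne']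

theorem posterior_nonneg {Q : Finset (A → stdSimplex ℝ Y)} (π₀ : stdSimplex ℝ Q) {t : ℕ}
    (h : History A Y t) (q : Q) : 0 ≤ posterior π₀ h q :=
  div_nonneg (mul_nonneg (π₀.2.1 q) (likelihood_nonneg _ _))
    (Finset.sum_nonneg fun q' _ => mul_nonneg (π₀.2.1 q') (likelihood_nonneg _ _))

end Posterior

/-! ### Lower bounds on empirical frequencies -/

section Frequencies

variable {A Y : Type*}

theorem empFreq_mem_Icc {t : ℕ} (h : History A Y t) (a : A) : empFreq h a ∈ Set.Icc (0 : ℝ) 1 := by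
  classical
  have h0 : 0 ≤ ∑ i, if (h i).1 = a then (1 : ℝ) else 0 :=
    Finset.sum_nonneg fun i _ => by split_ifs <;> norm_num
  have h1 : (∑ i, if (h i).1 = a then (1 : ℝ) else 0) ≤ t := by
    calc _ ≤ ∑ _i : Fin t, (1 : ℝ) := Finset.sum_le_sum fun i _ => by split_ifs <;> norm_num
      _ = t := by simp
  rw [empFreq, one_div_mul_eq_div]
  exact ⟨div_nonneg h0 (Nat.cast_nonneg t), div_le_one_of_le₀ h1 (Nat.cast_nonneg t)⟩

/-- An action whose weight in `α` exceeds the asymptotic gap is played with positive asymptotic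
frequency. -/
theorem exists_eventually_le_empFreq [Fintype A] {α : stdSimplex ℝ A} {ω : Path A Y} {a : A}
    (h : freqGap α ω < α a) :
    ∃ δ : ℝ, 0 < δ ∧ ∀ᶠ t : ℕ in atTop, δ ≤ empFreq (histAt ω t) a := by
  obtain ⟨r, hr1, hr2⟩ := exists_between h
  refine ⟨α a - r, by linarith, ?_⟩
  have hbdd : IsBoundedUnder (· ≤ ·) atTop
      fun t : ℕ => ∑ b, |empFreq (histAt ω t) b - α b| := by
    refine isBoundedUnder_of ⟨∑ b : A, (1 + |α b|), fun t => Finset.sum_le_sum fun b _ => ?_⟩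
    have hb := empFreq_mem_Icc (histAt ω t) b
    refine (abs_sub _ _).trans ?_
    rw [abs_of_nonneg hb.1]
    linarith [hb.2]
  filter_upwards [eventually_lt_of_limsup_lt hr1 hbdd] with t ht
  have h1 := Finset.single_le_sum (f := fun b => |empFreq (histAt ω t) b - α b|)
    (fun b _ => abs_nonneg _) (Finset.mem_univ a)
  have h2 := neg_abs_le (empFreq (histAt ω t) a - α a)
  linarith

end Frequencies

/-! ### Convergence of the values -/

/-- If the concern vanishes and so does the posterior probability of the models that misfit the
outcomes of `a`, the value of `a` tends to its true expected utility. -/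
theorem tendsto_beliefValue {A Y : Type*} [Fintype Y] (u : A → Y → ℝ)
    {Q : Finset (A → stdSimplex ℝ Y)} (hfull : FullSupport Q) {mubar : ℝ} (hmu : 0 ≤ mubar)
    {lam : ℕ → ℝ} (hlam : Tendsto lam atTop (𝓝[>] 0)) {π : ℕ → Q → ℝ}
    (hπ0 : ∀ t q, 0 ≤ π t q) (hπ1 : ∀ t, ∑ q, π t q = 1) (r : stdSimplex ℝ Y) (a : A)
    (hπ : ∀ q : Q, q.1 a ≠ r → Tendsto (fun t => π t q) atTop (𝓝 0)) :
    Tendsto (fun t => beliefValue u (lam t) (mubar * lam t) a (π t)) atTop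
      (𝓝 (∑ y, r y * u a y)) := by
  set m := ∑ y, r y * u a y with hm
  -- As the weights sum to one, the value minus `m` is the sum of these terms. If `q` fits `a`, the
  -- first factor vanishes and the weight is bounded; otherwise the weight vanishes and the first
  -- factor converges.
  have hterm : ∀ q : Q, Tendsto (fun t =>
      (robustValue (u a) (lam t) (mubar * lam t) (q.1 a) - m) * π t q) atTop (𝓝 0) := by
    intro q
    have hv := ((tendsto_robustValue (u a) hmu (q.1 a) (hfull q.1 q.2 a)).comp hlam).sub_const m
    by_cases hq : q.1 a = r
    · rw [hq, ← hm, sub_self] at hv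
      rw [hq]
      refine hv.zero_mul_isBoundedUnder_le (isBoundedUnder_of ⟨1, fun t => ?_⟩)
      have h1 := Finset.single_le_sum (fun q' _ => hπ0 t q') (Finset.mem_univ q)
      rw [hπ1] at h1
      simpa [abs_of_nonneg (hπ0 t q)] using h1
    · simpa using hv.mul (hπ q hq)
  have hsum := (tendsto_finsetSum Finset.univ fun q _ => hterm q).add_const m
  simp only [Finset.sum_const_zero, zero_add] at hsum
  refine hsum.congr fun t => ?_
  simp only [sub_mul, Finset.sum_sub_distrib, ← Finset.mul_sum, hπ1, mul_one, beliefValue,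
    sub_add_cancel]

/-- Under correct specification, the value of every action whose weight in `α` exceeds the
asymptotic gap tends to its true expected utility. -/
theorem ae_tendsto_beliefValue {A Y : Type*} [Fintype A] [Fintype Y] [MeasurableSpace A]
    [DiscreteMeasurableSpace A] [MeasurableSpace Y] [DiscreteMeasurableSpace Y]
    (u : A → Y → ℝ) {Q : Finset (A → stdSimplex ℝ Y)} (p : Q) (π₀ : stdSimplex ℝ Q)
    {c lambar mubar : ℝ} (σ : Policy A Y) (α : Path A Y → stdSimplex ℝ A) (hc : 0 < c)
    (hfull : FullSupport Q) (hp0 : 0 < π₀ p) (hmubar : 0 ≤ mubar)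
    (hbounded : BoundedConcern c Q p.1 σ lambar) :
    ∀ᵐ ω ∂pathMeasure p.1 σ, ∀ a, freqGap (α ω) ω < α ω a →
      Tendsto (fun t : ℕ => beliefValue u (concern c Q (histAt ω t))
        (mubar * concern c Q (histAt ω t)) a (posterior π₀ (histAt ω t)))
        atTop (𝓝 (∑ y, p.1 a y * u a y)) := by
  have hdev : ∀ᵐ ω ∂pathMeasure p.1 σ, ∀ z, Tendsto (fun t : ℕ =>
      (∑ i ∈ Finset.range t, deviation p.1 z (ω i)) / t) atTop (𝓝 0) :=
    ae_all_iff.2 fun z => ae_tendsto_average p.1 σ _ (sum_deviation_eq_zero p.1 z)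
  have hratio : ∀ᵐ ω ∂pathMeasure p.1 σ, ∀ q : Q, Tendsto (fun t : ℕ =>
      (∑ i ∈ Finset.range t, compensatedLogRatio p.1 q.1 (ω i)) / t) atTop (𝓝 0) :=
    ae_all_iff.2 fun q => ae_tendsto_average p.1 σ _ (sum_compensatedLogRatio_eq_zero p.1 q.1)
  filter_upwards [hdev, hratio, hbounded] with ω hω1 hω2 hω3 a hgap
  obtain ⟨δ, hδ, hfreq⟩ := exists_eventually_le_empFreq hgap
  have hlam := tendsto_concern hc p.2 (hfull p.1 p.2) hω1 fun t ht => (hω3 t ht).1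
  have hpost : ∀ q : Q, q.1 a ≠ p.1 a →
      Tendsto (fun t : ℕ => posterior π₀ (histAt ω t) q) atTop (𝓝 0) :=
    fun q hq => tendsto_posterior_zero hfull π₀ p q hp0 a hq hδ hfreq (hω2 q)
  have hnonneg : ∀ (t : ℕ) (q : Q), 0 ≤ posterior π₀ (histAt ω t) q :=
    fun t q => posterior_nonneg π₀ _ q
  have hone : ∀ t : ℕ, ∑ q : Q, posterior π₀ (histAt ω t) q = 1 :=
    fun t => sum_posterior hfull π₀ p hp0 _
  exact tendsto_beliefValue u hfull hmubar (lam := fun t => concern c Q (histAt ω t))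
    (π := fun t => posterior π₀ (histAt ω t)) hlam hnonneg hone (p.1 a) a hpost

end ComplexityAversion

theorem mainTheorem8 {A Y : Type*} [Fintype A] [Fintype Y] [MeasurableSpace A]
    [DiscreteMeasurableSpace A] [MeasurableSpace Y] [DiscreteMeasurableSpace Y]
    (u : A → Y → ℝ) (Q : Finset (A → stdSimplex ℝ Y)) (pstar : A → stdSimplex ℝ Y)
    (π₀ : stdSimplex ℝ Q) (c lambar mubar : ℝ) (σ : ComplexityAversion.Policy A Y)
    (α : ComplexityAversion.Path A Y → stdSimplex ℝ A)
    (hc : 0 < c)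
    (hfull : ComplexityAversion.FullSupport Q)
    (hcorrect : ComplexityAversion.CorrectlySpecified Q pstar)
    (hprior : ∀ q : Q, (∀ a, q.1 a = pstar a) → 0 < π₀ q)
    (hmubar : 0 ≤ mubar) (hkappa : mubar * lambar ^ 2 < 1)
    (hbounded : ComplexityAversion.BoundedConcern c Q pstar σ lambar)
    (hσ : ComplexityAversion.IsOptimal u c mubar π₀ σ)
    (hα : ComplexityAversion.IsLimitFrequency pstar σ α) :
    ∀ᵐ ω ∂ComplexityAversion.pathMeasure pstar σ, ∀ a, 0 < α ω a →
      ComplexityAversion.freqGap (α ω) ω < α ω a →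
      Tendsto (fun t : ℕ => ComplexityAversion.beliefValue u
          (ComplexityAversion.concern c Q (ComplexityAversion.histAt ω t))
          (mubar * ComplexityAversion.concern c Q (ComplexityAversion.histAt ω t)) a
          (ComplexityAversion.posterior π₀ (ComplexityAversion.histAt ω t)))
        atTop (𝓝 (∑ y, pstar a y * u a y)) := by
  obtain ⟨q, hq, hqeq⟩ := hcorrect
  -- Agreement at every action makes the true process itself a member of `Q`.
  obtain rfl : q = pstar := funext hqeq
  filter_upwards [ComplexityAversion.ae_tendsto_beliefValue u ⟨q, hq⟩ π₀ σ α hc hfull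
    (hprior ⟨q, hq⟩ fun _ => rfl) hmubar hbounded] with ω hω a _ hgap
  exact hω a hgap
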